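/- Let $B$ be a finitely generated group, let $I,J\le B$ be finitely generated subgroups, let $\varphi\colon I\to J$ be an isomorphism, and suppose that every abelian normal subgroup of $I$ is finitely generated. Let $$\pi=HNN(B;\varphi\colon I\cong J)=\langle B,t\mid tit^{-1}=\varphi(i)\ \text{for all } i\in I\rangle$$ be the HNN extension with base $B$ and associated subgroups $I,J$, and suppose that $\pi$ is a $2$-knot group, i.e. $\pi\cong\pi_1(S^4\setminus K(S^2))$ for some locally flat embedding $K\colon S^2\to S^4$. Let $A$ be a torsion-free abelian normal subgroup of $\pi$ of rank $1$. If $I$ and $J$ are both proper subgroups of $B$, then $A\cong\mathbb{Z}$. Otherwise (that is, if $I=B$ or $J=B$), $A\cong\mathbb{Z}[\frac1m]$ for some integer $m\ge1$, where $\mathbb{Z}[\frac1m]$ denotes the additive group of the subring of $\mathbb{Q}$ generated by $\frac1m$. -/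

import Mathlib

namespace TwoKnot

/-- The unit sphere `S^n` in Euclidean `(n+1)`-space. -/
abbrev Sph (n : ℕ) : Type :=
  Metric.sphere (0 : EuclideanSpace ℝ (Fin (n + 1))) 1

/-- A subset `K` of a topological space `X` is a locally flat surface:
each point of `K` has an open neighbourhood `U` in `X` such that the pair `(U, U ∩ K)` is
homeomorphic to `(ℝ⁴, ℝ² × {0})`. -/
def IsLocallyFlatSurface {X : Type*} [TopologicalSpace X] (K : Set X) : Prop :=
  ∀ x ∈ K, ∃ e : OpenPartialHomeomorph X (EuclideanSpace ℝ (Fin 4)),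
    x ∈ e.source ∧ e.target = Set.univ ∧
      ∀ y ∈ e.source, (y ∈ K ↔ (e y) 2 = 0 ∧ (e y) 3 = 0)

/-- A 2-knot: a locally flat embedding of `S²` in `S⁴`. -/
structure IsTwoKnot (k : Sph 2 → Sph 4) : Prop where
  isEmbedding : Topology.IsEmbedding k
  locallyFlat : IsLocallyFlatSurface (Set.range k)

/-- The complement of the image of a map `S² → S⁴`. -/
abbrev Complement (k : Sph 2 → Sph 4) : Type :=
  ((Set.range k)ᶜ : Set (Sph 4))

/-- A 2-knot group: a group isomorphic to the fundamental group of the complement of some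
2-knot. -/
def IsTwoKnotGroup (G : Type*) [Group G] : Prop :=
  ∃ k : Sph 2 → Sph 4, IsTwoKnot k ∧
    ∃ x : Complement k, Nonempty (G ≃* FundamentalGroup (Complement k) x)

end TwoKnot

open scoped IsMulCommutative

/-! If `I` and `J` are proper, Britton-type normal forms force `A` into the base: an element of `A`
with a stable letter has a conjugate that fails to commute with one of its own conjugates.
Conjugating by `t` then puts `A` inside `I`, so `A` is finitely generated and hence `ℤ`.

Otherwise `s = t` or `s = t⁻¹` conjugates the base `H` into itself. If the exponent map to `ℤ` is
nontrivial on `A`, rank one makes it injective there and `A ≅ ℤ`. If not, every element of `A` is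
carried by some power of `s` into `A ⊓ H`, which is infinite cyclic. Conjugation by `s` acts on `A`
as an `m`-th power and is onto, whence `ℤ[1/m]`. -/

theorem nonempty_addEquiv_int_of_rank_eq_one (M : Type*) [AddCommGroup M] [Module.Finite ℤ M]
    [Module.IsTorsionFree ℤ M] (hrank : Module.rank ℤ M = 1) : Nonempty (M ≃+ ℤ) := by
  have hfr : Module.finrank ℤ M = 1 := by simp [Module.finrank, hrank]
  exact ⟨(LinearEquiv.ofFinrankEq M ℤ (hfr.trans (Module.finrank_self ℤ).symm)).toAddEquiv⟩

theorem Subgroup.FG.finite_additive {G : Type*} [Group G] {A : Subgroup G}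
    [IsMulCommutative A] (hfg : A.FG) : Module.Finite ℤ (Additive A) := by
  have : Group.FG A := (Group.fg_iff_subgroup_fg A).2 hfg
  exact Module.Finite.iff_addGroup_fg.2 inferInstance

theorem Subgroup.rank_additive_eq_one_of_le {G : Type*} [Group G] {A N : Subgroup G}
    [IsMulCommutative A] [IsMulCommutative N] (htf : IsMulTorsionFree N)
    (hrank : Module.rank ℤ (Additive A) = 1) (hNA : N ≤ A) (hN : N ≠ ⊥) :
    Module.rank ℤ (Additive N) = 1 := by
  have : Nontrivial N := (Subgroup.nontrivial_iff_ne_bot N).2 hN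
  let f : Additive N →ₗ[ℤ] Additive A := (Subgroup.inclusion hNA).toAdditive.toIntLinearMap
  have hf : Function.Injective f := Subgroup.inclusion_injective hNA
  refine le_antisymm (hrank ▸ LinearMap.rank_le_of_injective f hf) ?_
  exact Cardinal.one_le_iff_pos.2 rank_pos

theorem Subgroup.inf_range_fg {G H : Type*} [Group G] [Group H] {f : H →* G}
    (hf : Function.Injective f)
    (hab : ∀ N : Subgroup H, N.Normal → IsMulCommutative N → N.FG)
    (A : Subgroup G) [A.Normal] [IsMulCommutative A] : (A ⊓ f.range).FG := by
  have h := hab (A.comap f) inferInstance (A.comap_injective_isMulCommutative hf)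
  have : Group.FG (A.comap f) := (Group.fg_iff_subgroup_fg _).2 h
  have := (Group.fg_iff_subgroup_fg _).1
    (Group.fg_of_surjective (f.subgroupMap_surjective (A.comap f)))
  rwa [Subgroup.map_comap_eq, inf_comm] at this

/-- The map `k ↦ k • z` satisfies the axioms of localization at the powers of `m`; injectivity of
multiplication by `m` comes from torsion-freeness. -/
theorem nonempty_addEquiv_localizationAway {R M : Type*} [CommRing R] [IsDomain R]
    [AddCommGroup M] [Module R M] [Module.IsTorsionFree R M] (z : M) (hz : z ≠ 0) (m : R)
    (hm : m ≠ 0) (hdiv : ∀ a : M, ∃ b : M, m • b = a)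
    (hgen : ∀ a : M, ∃ (n : ℕ) (k : R), m ^ n • a = k • z) :
    Nonempty (M ≃+ Localization.Away m) := by
  have : IsLocalizedModule (Submonoid.powers m) (LinearMap.toSpanSingleton R M z) := by
    refine ⟨?_, ?_, ?_⟩
    · rintro ⟨_, n, rfl⟩
      simp only [map_pow]
      refine IsUnit.pow n ((Module.End.isUnit_iff _).2 ⟨?_, hdiv⟩)
      exact smul_right_injective M hm
    · intro a
      obtain ⟨n, k, h⟩ := hgen a
      exact ⟨(k, ⟨m ^ n, n, rfl⟩), h⟩
    · intro x y h
      exact ⟨1, by simpa using smul_left_injective R hz h⟩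
  exact ⟨(IsLocalizedModule.linearEquiv (Submonoid.powers m) (LinearMap.toSpanSingleton R M z)
    (Algebra.linearMap R (Localization.Away m))).toAddEquiv⟩

theorem exists_zpow_mul_zpow_eq_one {G : Type*} [Group G] (A : Subgroup G)
    [IsMulCommutative A] (hrank : Module.rank ℤ (Additive A) = 1) {x y : G} (hx : x ∈ A)
    (hy : y ∈ A) : ∃ i j : ℤ, (i ≠ 0 ∨ j ≠ 0) ∧ x ^ i * y ^ j = 1 := by
  by_contra! h
  have hli : LinearIndependent ℤ ![Additive.ofMul (⟨x, hx⟩ : A), Additive.ofMul ⟨y, hy⟩] := by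
    rw [LinearIndependent.pair_iff]
    intro i j hij
    by_contra hne
    refine h i j (by tauto) ?_
    have := congrArg (fun z : Additive A => ((Additive.toMul z : A) : G)) hij
    simpa using this
  have := hli.cardinal_lift_le_rank
  rw [hrank] at this
  simp at this

/-! ### Ascending HNN extensions -/

theorem zpow_conj_mem_of_conj_mem {G : Type*} [Group G] {H : Subgroup G} {s : G}
    (hs : ∀ h ∈ H, s * h * s⁻¹ ∈ H) {g : G} {n k : ℤ} (hg : s ^ n * g * s ^ k ∈ H) {n' k' : ℤ}
    (hn : n ≤ n') (hk : n' + k' = n + k) : s ^ n' * g * s ^ k' ∈ H := by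
  obtain ⟨d, rfl⟩ := Int.le.dest hn
  obtain rfl : k' = k - d := by linarith
  clear hn hk
  induction d with
  | zero => simpa using hg
  | succ d ih =>
    convert hs _ ih using 1
    simp only [Nat.cast_succ]
    rw [show n + ((d : ℤ) + 1) = 1 + (n + d) by ring, show k - ((d : ℤ) + 1) = (k - d) + (-1) by ring,
      zpow_add s 1, zpow_add s (k - d)]
    simp [mul_assoc]

theorem exists_zpow_mul_mul_zpow_mem {G : Type*} [Group G] {H : Subgroup G} {s : G}
    (hs : ∀ h ∈ H, s * h * s⁻¹ ∈ H) (hgen : Subgroup.closure (insert s (H : Set G)) = ⊤) (g : G) :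
    ∃ n k : ℤ, s ^ n * g * s ^ k ∈ H := by
  have hg : g ∈ Subgroup.closure (insert s (H : Set G)) := hgen ▸ Subgroup.mem_top g
  induction hg using Subgroup.closure_induction with
  | mem x hx =>
    obtain rfl | hx := hx
    · exact ⟨0, -1, by simp⟩
    · exact ⟨0, 0, by simpa using hx⟩
  | one => exact ⟨0, 0, by simp⟩
  | mul x y _ _ hx hy =>
    obtain ⟨n, k, hx⟩ := hx
    obtain ⟨n', k', hy⟩ := hy
    -- Both left exponents are raised, keeping each exponent sum, until the inner powers of `s`
    -- cancel in the product.
    refine ⟨max n (n + k + n'), k' + n' - (max n (n + k + n') - n - k), ?_⟩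
    have h1 := zpow_conj_mem_of_conj_mem hs hx (n' := max n (n + k + n'))
      (k' := n + k - max n (n + k + n')) (le_max_left _ _) (by ring)
    have h2 := zpow_conj_mem_of_conj_mem hs hy (n' := max n (n + k + n') - n - k)
      (k' := k' + n' - (max n (n + k + n') - n - k))
      (by linarith [le_max_right n (n + k + n')]) (by ring)
    convert H.mul_mem h1 h2 using 1
    rw [show max n (n + k + n') - n - k = -(n + k - max n (n + k + n')) by ring, zpow_neg]
    group
  | inv x _ hx =>
    obtain ⟨n, k, hx⟩ := hx
    exact ⟨-k, -n, by convert H.inv_mem hx using 1; simp [mul_assoc]⟩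

/-- Let `G` be an ascending HNN extension with base `H` and stable letter `s`, with associated
homomorphism `p` to `ℤ`. An abelian normal subgroup `A` of rank one, contained in the kernel of
`p` and meeting `H` in a finitely generated subgroup, is isomorphic to some `ℤ[1/m]`. -/
theorem exists_addEquiv_localizationAway_of_le_ker {G : Type*} [Group G] (H : Subgroup G) (s : G)
    (p : G →* Multiplicative ℤ) (hpH : ∀ h ∈ H, p h = 1) (hps : p s = Multiplicative.ofAdd 1)
    (hs : ∀ h ∈ H, s * h * s⁻¹ ∈ H) (hgen : Subgroup.closure (insert s (H : Set G)) = ⊤)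
    (A : Subgroup G) [A.Normal] [IsMulCommutative A]
    (htf : IsMulTorsionFree A) (hrank : Module.rank ℤ (Additive A) = 1)
    (hfg : (A ⊓ H).FG) (hA : A ≤ p.ker) :
    ∃ m : ℕ, 1 ≤ m ∧ Nonempty (Additive A ≃+ Localization.Away (m : ℤ)) := by
  have hconj : ∀ a ∈ A, ∃ n : ℕ, s ^ n * a * (s ^ n)⁻¹ ∈ A ⊓ H := by
    intro a ha
    obtain ⟨n, k, h⟩ := exists_zpow_mul_mul_zpow_mem hs hgen a
    -- Since `p` kills both `a` and `H`, the exponents balance and the product is a genuine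
    -- conjugate.
    have hnk : n + k = 0 := by
      have := hpH _ h
      rw [map_mul, map_mul, map_zpow, map_zpow, hps, (MonoidHom.mem_ker).1 (hA ha)] at this
      simpa [← ofAdd_zsmul, ← ofAdd_add] using this
    have h' := zpow_conj_mem_of_conj_mem hs h (n' := n.toNat) (k' := -n.toNat)
      (Int.self_le_toNat n) (by omega)
    refine ⟨n.toNat, Subgroup.Normal.conj_mem ‹A.Normal› _ ha _, ?_⟩
    rwa [zpow_neg, zpow_natCast] at h'
  have hcomm : IsMulCommutative (A ⊓ H : Subgroup G) :=
    IsMulCommutative.of_setLike_mul_comm fun a ha b hb =>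
      setLike_mul_comm ha.1 hb.1
  have htf' : IsMulTorsionFree (A ⊓ H : Subgroup G) :=
    (Subgroup.inclusion_injective (inf_le_left : A ⊓ H ≤ A)).isMulTorsionFree
      (Subgroup.inclusion _)
  have hne : A ⊓ H ≠ ⊥ := by
    intro hbot
    have hA' : A = ⊥ := by
      refine (Subgroup.eq_bot_iff_forall A).2 fun a ha => ?_
      obtain ⟨n, hn⟩ := hconj a ha
      simpa [hbot, mul_inv_eq_one] using hn
    have : Subsingleton A := by rw [hA']; infer_instance
    have : Subsingleton (Additive A) := this
    simp at hrank
  obtain ⟨z, hzAH, hzne, hzgen⟩ : ∃ z ∈ A ⊓ H, z ≠ 1 ∧ ∀ x ∈ A ⊓ H, ∃ k : ℤ, x = z ^ k := by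
    have := hfg.finite_additive
    obtain ⟨e⟩ := nonempty_addEquiv_int_of_rank_eq_one (Additive (A ⊓ H : Subgroup G))
      (Subgroup.rank_additive_eq_one_of_le htf' hrank inf_le_left hne)
    have key : ∀ x (hx : x ∈ A ⊓ H), x = (((e.symm 1).toMul : (A ⊓ H : Subgroup G)) : G) ^
        (e (Additive.ofMul ⟨x, hx⟩)) := by
      intro x hx
      have h1 : Additive.ofMul (⟨x, hx⟩ : (A ⊓ H : Subgroup G)) =
          e (Additive.ofMul ⟨x, hx⟩) • e.symm 1 := by
        rw [← map_zsmul, smul_eq_mul, mul_one, e.symm_apply_apply]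
      have := congrArg (fun w : Additive (A ⊓ H : Subgroup G) => (w.toMul : G)) h1
      simpa using this
    refine ⟨_, ((e.symm 1).toMul : (A ⊓ H : Subgroup G)).2, fun h1 => hne ?_,
      fun x hx => ⟨_, key x hx⟩⟩
    refine (Subgroup.eq_bot_iff_forall _).2 fun x hx => ?_
    rw [key x hx, h1, one_zpow]
  obtain ⟨m, hm⟩ := hzgen (s * z * s⁻¹)
    ⟨Subgroup.Normal.conj_mem ‹A.Normal› _ hzAH.1 _, hs z hzAH.2⟩
  have hm0 : m ≠ 0 := by
    rintro rfl
    rw [zpow_zero, conj_eq_one_iff] at hm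
    exact hzne hm
  -- After conjugation by `s ^ n`, which commutes with `s`, the element `a` becomes a power of `z`,
  -- where the claim is `hm`.
  have hact : ∀ a ∈ A, s * a * s⁻¹ = a ^ m := by
    intro a ha
    obtain ⟨n, hn⟩ := hconj a ha
    obtain ⟨k, hk⟩ := hzgen _ hn
    have h1 : s ^ n * (s * a * s⁻¹) * (s ^ n)⁻¹ = s ^ n * a ^ m * (s ^ n)⁻¹ := by
      rw [← conj_zpow, hk, ← zpow_mul, mul_comm k m, zpow_mul, ← hm, conj_zpow, ← hk]
      simp only [mul_assoc, ← mul_inv_rev, ← pow_succ, ← pow_succ']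
      simp only [← mul_assoc, ← pow_succ, ← pow_succ']
    simpa using h1
  have hact' : ∀ (n : ℕ), ∀ a ∈ A, s ^ n * a * (s ^ n)⁻¹ = a ^ (m ^ n) := by
    intro n a ha
    induction n with
    | zero => simp
    | succ n ih =>
      rw [pow_succ m, zpow_mul, ← hact _ (A.zpow_mem ha _), ← ih, pow_succ']
      simp [mul_assoc]
  have hdiv : ∀ a : Additive A, ∃ b : Additive A, m • b = a := by
    intro a
    have hb : s⁻¹ * (a.toMul : G) * s ∈ A := by
      simpa using Subgroup.Normal.conj_mem ‹A.Normal› _ a.toMul.2 s⁻¹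
    refine ⟨Additive.ofMul ⟨_, hb⟩, Additive.toMul.injective (Subtype.ext ?_)⟩
    have := hact _ hb
    simp only [toMul_zsmul, toMul_ofMul, Subgroup.coe_zpow, ← this]
    simp [mul_assoc]
  have hgen' : ∀ a : Additive A, ∃ (n : ℕ) (k : ℤ),
      m ^ n • a = k • Additive.ofMul (⟨z, hzAH.1⟩ : A) := by
    intro a
    obtain ⟨n, hn⟩ := hconj _ a.toMul.2
    obtain ⟨k, hk⟩ := hzgen _ hn
    refine ⟨n, k, Additive.toMul.injective (Subtype.ext ?_)⟩
    rw [hact' n _ a.toMul.2] at hk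
    simpa using hk
  refine ⟨m.natAbs, Int.natAbs_pos.2 hm0, ?_⟩
  -- The exponent `m` may be negative; signs are absorbed in `b` and `k`.
  rw [Int.natCast_natAbs]
  refine nonempty_addEquiv_localizationAway (Additive.ofMul (⟨z, hzAH.1⟩ : A)) ?_ |m| (by simpa)
    (fun a => ?_) (fun a => ?_)
  · intro h
    exact hzne (congrArg (fun w : Additive A => (w.toMul : G)) h)
  · obtain ⟨b, hb⟩ := hdiv a
    obtain h | h := abs_choice m
    · exact ⟨b, by rw [h, hb]⟩
    · exact ⟨-b, by rw [h, neg_smul_neg, hb]⟩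
  · obtain ⟨n, k, hk⟩ := hgen' a
    obtain h | h := abs_choice (m ^ n)
    · exact ⟨n, k, by rw [← abs_pow, h, hk]⟩
    · exact ⟨n, -k, by rw [← abs_pow, h, neg_smul, hk, neg_smul]⟩

theorem nonempty_addEquiv_int_of_not_le_ker {G : Type*} [Group G] (p : G →* Multiplicative ℤ)
    (A : Subgroup G) [IsMulCommutative A] (htf : IsMulTorsionFree A)
    (hrank : Module.rank ℤ (Additive A) = 1) (hA : ¬ A ≤ p.ker) :
    Nonempty (Additive A ≃+ ℤ) := by
  obtain ⟨y, hyA, hy⟩ := SetLike.not_le_iff_exists.1 hA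
  let f : Additive A →+ ℤ := MonoidHom.toAdditiveLeft (p.comp A.subtype)
  have hf : Function.Injective f := by
    refine (injective_iff_map_eq_zero f).2 fun x hx => ?_
    have hpx : p (x.toMul : G) = 1 := hx
    obtain ⟨i, j, hij, h⟩ := exists_zpow_mul_zpow_eq_one A hrank x.toMul.2 hyA
    have hj : j = 0 := by
      have := congrArg p h
      rw [map_mul, map_zpow, map_zpow, hpx, one_zpow, one_mul, map_one] at this
      by_contra hj
      exact hy ((IsMulTorsionFree.zpow_eq_one_iff_left hj).1 this)
    subst hj
    have hi : i ≠ 0 := by tauto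
    rw [zpow_zero, mul_one] at h
    have h' : x.toMul ^ i = 1 := Subtype.ext (by simpa using h)
    exact Additive.toMul.injective ((IsMulTorsionFree.zpow_eq_one_iff_left hi).1 h')
  have : Module.Finite ℤ (Additive A) := Module.Finite.of_injective f.toIntLinearMap hf
  exact nonempty_addEquiv_int_of_rank_eq_one _ hrank

theorem exists_addEquiv_localizationAway_of_conj_mem {G : Type*} [Group G] (H : Subgroup G) (s : G)
    (p : G →* Multiplicative ℤ) (hpH : ∀ h ∈ H, p h = 1) (hps : p s = Multiplicative.ofAdd 1)
    (hs : ∀ h ∈ H, s * h * s⁻¹ ∈ H) (hgen : Subgroup.closure (insert s (H : Set G)) = ⊤)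
    (A : Subgroup G) [A.Normal] [IsMulCommutative A]
    (htf : IsMulTorsionFree A) (hrank : Module.rank ℤ (Additive A) = 1)
    (hfg : (A ⊓ H).FG) :
    ∃ m : ℕ, 1 ≤ m ∧ Nonempty (Additive A ≃+ Localization.Away (m : ℤ)) := by
  by_cases hA : A ≤ p.ker
  · exact exists_addEquiv_localizationAway_of_le_ker H s p hpH hps hs hgen A htf hrank hfg hA
  · obtain ⟨e⟩ := nonempty_addEquiv_int_of_not_le_ker p A htf hrank hA
    refine ⟨1, le_rfl, ⟨e.trans ?_⟩⟩
    rw [Nat.cast_one]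
    exact (IsLocalization.atOne ℤ (Localization.Away (1 : ℤ))).toAddEquiv

/-! ### Normal forms and abelian normal subgroups -/

namespace HNNExtension

open NormalWord

variable {G : Type*} [Group G] {I J : Subgroup G} {φ : I ≃* J}

/-- The element of the HNN extension spelled by a list of letters `t ^ u * g`. -/
def listProd (φ : I ≃* J) (l : List (ℤˣ × G)) : HNNExtension G I J φ :=
  (l.map (fun x => t ^ (x.1 : ℤ) * of x.2)).prod

@[simp] theorem listProd_nil : listProd φ [] = 1 := rfl

@[simp] theorem listProd_cons (x : ℤˣ × G) (l : List (ℤˣ × G)) :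
    listProd φ (x :: l) = t ^ (x.1 : ℤ) * of x.2 * listProd φ l := by
  simp [listProd]

@[simp] theorem listProd_append (l l' : List (ℤˣ × G)) :
    listProd φ (l ++ l') = listProd φ l * listProd φ l' := by
  simp [listProd]

/-- A list of letters without subword `t ^ u * g * t ^ (-u)` where `g ∈ toSubgroup I J u`. -/
abbrev IsReducedList (I J : Subgroup G) (l : List (ℤˣ × G)) : Prop :=
  l.IsChain (fun a b => a.2 ∈ toSubgroup I J a.1 → a.1 = b.1)

theorem exists_eq_of_mul_listProd (x : HNNExtension G I J φ) :
    ∃ (g : G) (l : List (ℤˣ × G)), IsReducedList I J l ∧ x = of g * listProd φ l := by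
  obtain ⟨d⟩ := TransversalPair.nonempty G I J
  let w : NormalWord d := x • empty
  refine ⟨w.head, w.toList, w.chain, ?_⟩
  have h : w.prod φ = x := by simp [w, prod_smul]
  exact h.symm

theorem isReducedList_concat_congr {l : List (ℤˣ × G)} {u : ℤˣ} {a : G} (b : G)
    (h : IsReducedList I J (l ++ [(u, a)])) : IsReducedList I J (l ++ [(u, b)]) := by
  simp only [IsReducedList, List.isChain_append] at h ⊢
  exact ⟨h.1, by simp, fun x hx y hy => by
    have := h.2.2 x hx (u, a) (by simp)
    simp only [List.head?_cons, Option.mem_some_iff] at hy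
    subst hy
    exact this⟩

/-- Reduced concatenation after replacing the last group entry by `x`, when `x` is outside the
relevant associated subgroup. -/
theorem isReducedList_append {l l' : List (ℤˣ × G)} {u : ℤˣ} {a x : G}
    (h : IsReducedList I J (l ++ [(u, a)])) (h' : IsReducedList I J l')
    (hx : x ∉ toSubgroup I J u) : IsReducedList I J (l ++ (u, x) :: l') := by
  have h1 := isReducedList_concat_congr x h
  rw [List.append_cons]
  refine List.isChain_append.2 ⟨h1, h', fun z hz w _ hzu => absurd hzu ?_⟩
  simp only [List.getLast?_append, List.getLast?_singleton, Option.some_or,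
    Option.mem_some_iff] at hz
  rwa [← hz]

/-- Opposite outer letters make both products reduced as written. Their heads are `1` and `x`, so
equality would put `x` in the excluded associated subgroup. -/
theorem not_commute_conj_of_isReducedList {l : List (ℤˣ × G)} {e : ℤˣ} {c x : G}
    (h : IsReducedList I J ((e, c) :: l ++ [(-e, 1)])) (hx : x ∉ toSubgroup I J (-e)) :
    ¬ Commute (listProd φ ((e, c) :: l ++ [(-e, 1)]))
      (of x * listProd φ ((e, c) :: l ++ [(-e, 1)]) * (of x)⁻¹) := by
  intro hcomm
  have hx' : x⁻¹ ∉ toSubgroup I J (-e) := by simpa using hx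
  let w₁ : ReducedWord G I J :=
    ⟨1, _, isReducedList_append h (isReducedList_concat_congr x⁻¹ h) hx⟩
  let w₂ : ReducedWord G I J := ⟨x, _, isReducedList_append h h hx'⟩
  have hw : w₁.prod φ = w₂.prod φ := by
    change of 1 * listProd φ ((e, c) :: l ++ (-e, x) :: ((e, c) :: l ++ [(-e, x⁻¹)])) =
      of x * listProd φ ((e, c) :: l ++ (-e, x⁻¹) :: ((e, c) :: l ++ [(-e, 1)]))
    have := hcomm.eq
    simp only [listProd_append, listProd_cons, listProd_nil, map_one, mul_one, one_mul, map_inv,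
      mul_assoc] at this ⊢
    exact this
  have := (ReducedWord.map_fst_eq_and_of_prod_eq φ hw).2 e (by simp [w₁])
  exact hx (by simpa [w₁, w₂] using this)

theorem toSubgroup_ne_top (hI : I ≠ ⊤) (hJ : J ≠ ⊤) (u : ℤˣ) : toSubgroup I J u ≠ ⊤ := by
  obtain rfl | rfl := Int.units_eq_one_or u <;> simpa

theorem le_range_of_of_isMulCommutative (hI : I ≠ ⊤) (hJ : J ≠ ⊤)
    (A : Subgroup (HNNExtension G I J φ)) [A.Normal] [IsMulCommutative A] :
    A ≤ (of : G →* HNNExtension G I J φ).range := by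
  intro a ha
  obtain ⟨b, l, hl, rfl⟩ := exists_eq_of_mul_listProd a
  obtain rfl | ⟨l₀, ⟨u, g⟩, rfl⟩ := l.eq_nil_or_concat'
  · simp
  exfalso
  obtain ⟨e, he⟩ : ∃ e : ℤˣ, ∀ z ∈ (l₀ ++ [(u, g)]).head?, z.1 = e := by
    cases l₀ <;> simp
  obtain ⟨y, hy⟩ : ∃ y, y ∉ toSubgroup I J u := by
    simpa [Subgroup.eq_top_iff'] using toSubgroup_ne_top hI hJ u
  obtain ⟨x, hx⟩ : ∃ x, x ∉ toSubgroup I J (-e) := by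
    simpa [Subgroup.eq_top_iff'] using toSubgroup_ne_top hI hJ (-e)
  -- Taking `e` to be the first sign prevents cancellation on the left; `y` outside the associated
  -- subgroup prevents it on the right.
  have hred : IsReducedList I J ((e, y⁻¹ * g * b) :: (l₀ ++ [(u, y)]) ++ [(-e, 1)]) := by
    have h1 : IsReducedList I J (l₀ ++ (u, y) :: [(-e, 1)]) :=
      isReducedList_append hl (by simp [IsReducedList]) hy
    have h2 : ∀ z ∈ (l₀ ++ (u, y) :: [(-e, 1)]).head?, z.1 = e := by
      cases l₀ <;> simpa using he
    simp only [List.cons_append, List.append_assoc, List.nil_append]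
    rw [IsReducedList, List.isChain_cons]
    exact ⟨fun z hz _ => (h2 z hz).symm, h1⟩
  set M := (e, y⁻¹ * g * b) :: (l₀ ++ [(u, y)]) ++ [(-e, (1 : G))] with hM
  have hmem : listProd φ M ∈ A := by
    have := Subgroup.Normal.conj_mem ‹A.Normal› _ ha (t ^ (e : ℤ) * of (y⁻¹ * g))
    convert this using 1
    simp [hM, mul_assoc]
  refine not_commute_conj_of_isReducedList (φ := φ) hred hx ?_
  exact setLike_mul_comm hmem
    (Subgroup.Normal.conj_mem ‹A.Normal› _ hmem _)

theorem le_map_of_of_isMulCommutative (hI : I ≠ ⊤) (hJ : J ≠ ⊤)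
    (A : Subgroup (HNNExtension G I J φ)) [A.Normal] [IsMulCommutative A] :
    A ≤ I.map (of : G →* HNNExtension G I J φ) := by
  intro a ha
  obtain ⟨b, rfl⟩ := le_range_of_of_isMulCommutative hI hJ A ha
  refine ⟨b, ?_, rfl⟩
  by_contra hb
  have hmem := le_range_of_of_isMulCommutative hI hJ A
    (Subgroup.Normal.conj_mem ‹A.Normal› _ ha t)
  -- For `b ∉ I` the word `t * b * t⁻¹` is reduced, so it cannot lie in the base.
  let w : ReducedWord G I J := ⟨1, [(1, b), (-1, 1)], by simpa using hb⟩
  have hw : w.prod φ = t * of b * t⁻¹ := by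
    change of 1 * listProd φ [(1, b), (-1, 1)] = _
    simp [mul_assoc]
  have := ReducedWord.toList_eq_nil_of_mem_of_range φ w (hw ▸ hmem)
  simp [w] at this

end HNNExtension

/-! ### Exponent map and the two cases -/

namespace HNNExtension

variable {G : Type*} [Group G] {I J : Subgroup G} {φ : I ≃* J}

/-- The homomorphism to `ℤ` that kills the base and sends the stable letter to `n`. -/
def exponentHom (φ : I ≃* J) (n : ℤ) : HNNExtension G I J φ →* Multiplicative ℤ :=
  lift 1 (Multiplicative.ofAdd n) (by simp)

theorem closure_insert_range_of {s : HNNExtension G I J φ} (hs : s = t ∨ s = t⁻¹) :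
    Subgroup.closure (insert s ((of : G →* HNNExtension G I J φ).range : Set _)) = ⊤ := by
  have hmem : s ∈ Subgroup.closure (insert s ((of : G →* HNNExtension G I J φ).range : Set _)) :=
    Subgroup.subset_closure (Set.mem_insert _ _)
  refine (Subgroup.eq_top_iff' _).2 fun x => ?_
  induction x using induction_on with
  | of g => exact Subgroup.subset_closure (Set.mem_insert_of_mem _ ⟨g, rfl⟩)
  | t =>
    obtain rfl | rfl := hs
    · exact hmem
    · exact inv_mem_iff.1 hmem
  | mul x y hx hy => exact mul_mem hx hy
  | inv x hx => exact inv_mem hx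

end HNNExtension

open HNNExtension in
theorem mainTheorem6 {B : Type*} [Group B] (I J : Subgroup B) (φ : I ≃* J)
    (hπ : TwoKnot.IsTwoKnotGroup (HNNExtension B I J φ))
    (hB : Group.FG B) (hI : I.FG) (hJ : J.FG)
    (hab : ∀ N : Subgroup I, N.Normal → IsMulCommutative N → N.FG)
    (A : Subgroup (HNNExtension B I J φ)) [A.Normal] [IsMulCommutative A]
    (htf : IsMulTorsionFree A) (hrank : Module.rank ℤ (Additive A) = 1) :
    ((I ≠ ⊤ ∧ J ≠ ⊤) → Nonempty (Additive A ≃+ ℤ)) ∧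
    (¬ (I ≠ ⊤ ∧ J ≠ ⊤) →
      ∃ m : ℕ, 1 ≤ m ∧ Nonempty (Additive A ≃+ Localization.Away (m : ℤ))) := by
  have hfgI := Subgroup.inf_range_fg (f := (of : B →* HNNExtension B I J φ).comp I.subtype)
    ((of_injective φ).comp I.subtype_injective) hab A
  -- The finiteness hypothesis on `I` is transported to `J` through `φ`.
  have hfgJ := Subgroup.inf_range_fg
    (f := ((of : B →* HNNExtension B I J φ).comp J.subtype).comp φ.toMonoidHom)
    (((of_injective φ).comp J.subtype_injective).comp φ.injective) hab A
  rw [MonoidHom.range_comp, Subgroup.range_subtype] at hfgI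
  rw [MonoidHom.range_comp, MonoidHom.range_eq_top.2 φ.surjective, ← MonoidHom.range_eq_map,
    MonoidHom.range_comp, Subgroup.range_subtype] at hfgJ
  refine ⟨fun ⟨h₁, h₂⟩ => ?_, fun h => ?_⟩
  · rw [inf_eq_left.2 (le_map_of_of_isMulCommutative h₁ h₂ A)] at hfgI
    have := hfgI.finite_additive
    exact nonempty_addEquiv_int_of_rank_eq_one _ hrank
  · obtain rfl | rfl : I = ⊤ ∨ J = ⊤ := by tauto
    · rw [← MonoidHom.range_eq_map] at hfgI
      refine exists_addEquiv_localizationAway_of_conj_mem (of : B →* HNNExtension B ⊤ J φ).range t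
        (exponentHom φ 1) ?_ (lift_t _ _ _) ?_ (closure_insert_range_of (.inl rfl)) A htf hrank hfgI
      · rintro _ ⟨b, rfl⟩
        simp [exponentHom]
      · rintro _ ⟨b, rfl⟩
        exact ⟨_, equiv_eq_conj (φ := φ) ⟨b, Subgroup.mem_top b⟩⟩
    · rw [← MonoidHom.range_eq_map] at hfgJ
      refine exists_addEquiv_localizationAway_of_conj_mem (of : B →* HNNExtension B I ⊤ φ).range t⁻¹
        (exponentHom φ (-1)) ?_ ?_ ?_ (closure_insert_range_of (.inr rfl)) A htf hrank hfgJ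
      · rintro _ ⟨b, rfl⟩
        simp [exponentHom]
      · simp [exponentHom]
      · rintro _ ⟨b, rfl⟩
        rw [inv_inv]
        exact ⟨_, equiv_symm_eq_conj (φ := φ) ⟨b, Subgroup.mem_top b⟩⟩
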